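/- There is a universal constant $c>0$ such that the following holds. Let $X$ be a domain and let $C$ be a class of functions $f:X\to\{-1,1\}$ that is closed under negation ($f\in C$ implies $-f\in C$). The margin complexity $\mathrm{mc}(C)$ is the infimum of the $M>0$ such that for some $d$ there is a map $\Psi$ from $X$ to the unit ball of $\mathbb{R}^d$ with the property that for every $f\in C$ there is $w\in\mathbb{R}^d$, $\|w\|_2\le 1$, with $f(x)\langle w,\Psi(x)\rangle\ge 1/M$ for all $x\in X$ ($\mathrm{mc}(C)=\infty$ if there is no such $M$). Let $Z=X\times\{-1,1\}$. An $\varepsilon$-local randomizer is a randomized map $R$ from $Z$ to a set $W$, with discrete output distributions, such that $\Pr[R(z_1)=w]\le e^{\varepsilon}\Pr[R(z_2)=w]$ for all $z_1,z_2\in Z$, $w\in W$. An $\varepsilon$-LDP algorithm is a (discretely) randomized algorithm that accesses its dataset $(z_1,\dots,z_n)\in Z^n$ only by queries $(i,R)$, where $i$ is an index and $R$ is a local randomizer, each of which is answered by a sample of $R(z_i)$; in every execution, if $R_1,\dots,R_k$ are the randomizers used on an index $i$ and $R_j$ is an $\varepsilon_j$-local randomizer, then $\sum_j\varepsilon_j\le\varepsilon$.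 Each index is queried at most once in every execution. The algorithm is label-non-adaptive if, once its initial random bits are fixed, every query either is determined in advance, independently of all answers, or is label-independent, that is, the distribution of $R(x,y)$ does not depend on $y$. Suppose that, for some $\varepsilon\ge 0$ and $n$, there is a label-non-adaptive $\varepsilon$-LDP algorithm such that for every discrete probability distribution $D$ on $X$ and every $f\in C$, when it is run on $n$ i.i.d. examples $(x,f(x))$ with $x\sim D$, it outputs with probability at least $2/3$ a function $h:X\to\{-1,1\}$ with $\Pr_{x\sim D}[f(x)\ne h(x)]<1/2$. Then $$n\ \ge\ c\cdot\frac{\mathrm{mc}(C)^{2/3}}{e^{\varepsilon}} .$$ (In particular $\mathrm{mc}(C)<\infty$.) -/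

import Mathlib

open scoped ENNReal

noncomputable section

/-- `R : Z → W` (a randomized map with discrete output) is an `ε`-local randomizer:
`Pr[R(z₁) = w] ≤ e^ε · Pr[R(z₂) = w]` for all inputs `z₁, z₂` and all outputs `w`. -/
def IsLocalRandomizer {Z W : Type*} (ε : ℝ) (R : Z → PMF W) : Prop :=
  ∀ z₁ z₂ w, R z₁ w ≤ ENNReal.ofReal (Real.exp ε) * R z₂ w

/-- A randomizer of labelled examples is label-independent if it depends only on the point. -/
def IsLabelIndependent {X Y W : Type*} (R : X × Y → PMF W) : Prop :=
  ∀ x y y', R (x, y) = R (x, y')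

/-- One step of a server that has access to a dataset `S ∈ Z^n` only through the oracle `LR_S`:
either it tosses a coin of its own, or it sends to the oracle an index `i` and a randomizer `R`
and receives a sample of `R(z_i)`. -/
inductive Step (Z W : Type*) (n : ℕ)
  | coin (p : PMF W) : Step Z W n
  | query (i : Fin n) (R : Z → PMF W) : Step Z W n

/-- The law of the value received in a step, when the dataset is `S`. -/
def Step.law {Z W : Type*} {n : ℕ} (S : Fin n → Z) : Step Z W n → PMF W
  | .coin p => p
  | .query i R => R (S i)

/-- An interactive protocol. The step to take and the final output are functions of the history,
the list of all values received so far (most recent first). The protocol stops after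
`rounds` steps. -/
structure Protocol (Z W H : Type*) (n : ℕ) where
  rounds : ℕ
  next : List W → Step Z W n
  output : List W → H

namespace Protocol

variable {Z W H : Type*} {n : ℕ}

/-- The law of the history after `t` steps on the dataset `S`. -/
def history (P : Protocol Z W H n) (S : Fin n → Z) : ℕ → PMF (List W)
  | 0 => PMF.pure []
  | t + 1 => (P.history S t).bind fun h => ((P.next h).law S).map fun w => w :: h

/-- The law of the output on the dataset `S`. -/
def run (P : Protocol Z W H n) (S : Fin n → Z) : PMF H :=
  (P.history S P.rounds).map P.output

open Classical in
/-- If the oracle call made after a history `h` costs `b h`, then `P.spent b i h` is the total cost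
of the oracle calls on the index `i` that were made in the course of the history `h`. -/
def spent (P : Protocol Z W H n) (b : List W → ℝ) (i : Fin n) : List W → ℝ
  | [] => 0
  | _ :: h => P.spent b i h + if ∃ R, P.next h = .query i R then b h else 0

/-- (Compositional) `ε`-local differential privacy: every oracle call uses an `ε_j`-local
randomizer, and in every execution the `ε_j` of the calls on any fixed index sum to at
most `ε`. -/
def IsLDP (P : Protocol Z W H n) (ε : ℝ) : Prop :=
  ∃ b : List W → ℝ,
    (∀ h, h.length < P.rounds → ∀ i R, P.next h = .query i R → IsLocalRandomizer (b h) R) ∧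
    ∀ h, h.length ≤ P.rounds → ∀ i, P.spent b i h ≤ ε

/-- In every execution each index is used in at most one oracle call. -/
def QueriesOnce (P : Protocol Z W H n) : Prop :=
  ∀ h, h.length ≤ P.rounds → ∀ i, P.spent (fun _ => 1) i h ≤ 1

/-- Label-non-adaptivity: every step either is fixed in advance (it is the same for all
histories), or its oracle calls are label-independent, whatever the history. -/
def IsLabelNonadaptive {X Y : Type*} (P : Protocol (X × Y) W H n) : Prop :=
  ∀ t < P.rounds,
    (∃ s, ∀ h, h.length = t → P.next h = s) ∨
    (∀ h, h.length = t → ∀ i R, P.next h = .query i R → IsLabelIndependent R)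

end Protocol

/-- The law of `n` independent samples of `p`. -/
def iidSample {Z : Type*} (p : PMF Z) : (n : ℕ) → PMF (Fin n → Z)
  | 0 => PMF.pure Fin.elim0
  | n + 1 => p.bind fun z => (iidSample p n).map fun S => (Fin.cons z S : Fin (n + 1) → Z)

/-- A randomized algorithm is a distribution over protocols (the protocol is drawn before any
oracle call; it may toss further coins later). A label-non-adaptive `ε`-LDP algorithm for `n`
labelled examples, each of which is queried at most once. -/
def IsLabelNonadaptiveLDP {X W H : Type*} {n : ℕ} (A : PMF (Protocol (X × ℤˣ) W H n))
    (ε : ℝ) : Prop :=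
  ∀ P ∈ A.support, P.IsLDP ε ∧ P.QueriesOnce ∧ P.IsLabelNonadaptive

/-- The law of the output of `A` on `n` i.i.d. examples `(x, f x)` with `x ∼ D`. -/
def learnerOutput {X W H : Type*} {n : ℕ} (A : PMF (Protocol (X × ℤˣ) W H n))
    (D : PMF X) (f : X → ℤˣ) : PMF H :=
  A.bind fun P => (iidSample (D.map fun x => (x, f x)) n).bind fun S => P.run S

/-- The error `Pr_{x ∼ D}[f(x) ≠ h(x)]` of the hypothesis `h`. -/
def hypError {X : Type*} (D : PMF X) (f h : X → ℤˣ) : ℝ≥0∞ :=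
  D.toOuterMeasure {x | f x ≠ h x}

/-- `A` PAC learns `C` distribution-independently with error less than `α` and success probability
at least `p`. Boolean functions take the values `1` and `-1`. -/
def PACLearns {X W : Type*} {n : ℕ} (A : PMF (Protocol (X × ℤˣ) W (X → ℤˣ) n))
    (C : Set (X → ℤˣ)) (α p : ℝ≥0∞) : Prop :=
  ∀ D : PMF X, ∀ f ∈ C, p ≤ (learnerOutput A D f).toOuterMeasure {h | hypError D f h < α}

/-- For some `d` there is a map of `X` to the unit ball of `ℝ^d` under which every `f ∈ C` is
separated by a vector of the unit ball with margin at least `γ`. -/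
def HasMargin {X : Type*} (C : Set (X → ℤˣ)) (γ : ℝ) : Prop :=
  ∃ (d : ℕ) (Ψ : X → EuclideanSpace ℝ (Fin d)), (∀ x, ‖Ψ x‖ ≤ 1) ∧
    ∀ f ∈ C, ∃ w : EuclideanSpace ℝ (Fin d), ‖w‖ ≤ 1 ∧
      ∀ x, γ ≤ ((f x : ℤ) : ℝ) * inner ℝ w (Ψ x)

/-- The margin complexity of `C`: the least `M` such that `C` has margin `1 / M`
(it is `∞` if there is none). -/
def marginComplexity {X : Type*} (C : Set (X → ℤˣ)) : ℝ≥0∞ :=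
  sInf {m | ∃ M : ℝ, 0 < M ∧ HasMargin C (1 / M) ∧ m = ENNReal.ofReal M}

end

/-!
Consider a labelling `f ∈ C` and its negation on a point distribution `D`. A hypothesis with error
below `1/2` for `f` has error above `1/2` for `-f`, so a learner that succeeds on both with
probability `2/3` distinguishes them with advantage at least `1/3`
(`third_le_tsum_of_pacLearns`). Because no index is queried twice, a query with randomizer `R` on
i.i.d. data is answered by a fresh sample of the mixture of `R`
(`Protocol.iidSample_bind_run`), and a hybrid argument over the steps (`historyChain_expect_le`)
bounds the advantage by the sum of the total variation distances of the single answers.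
Label-independent queries contribute nothing. The remaining ones are fixed in advance, so they have
distinct indices and there are at most `n` of them.

The answer `w` of a query with randomizer `R` contributes the positive part of `E_D[f G_w]`, where
`G_w x = R (x, 1) w - R (x, -1) w` does not depend on `f`, and privacy gives
`|G_w| ≤ e^ε * R z₀ w` for any fixed `z₀`. Summed over `w`, over the queries and over the
randomness of the algorithm, these bounds amount to at most `B = n * e^ε`. Hence there is one family
of functions `G j` with `|G j| ≤ a j` and `∑ a j ≤ B` such that the positive parts of `E_D[f G j]`
sum to at least `1/3`, for all `f ∈ C` and all `D`.

A tail of the family may be dropped at the cost of `1/6`. For finitely many `j`, Hahn-Banach (the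
minimax theorem, `exists_weights_of_forall_sum_posPart`) exchanges the quantifiers: there are
coefficients `s j ∈ [0, 1]` with `f x * ∑ s j * G j x ≥ 1/6` for all `x`. Rescaling the coordinate
`j` by `√(a j * B)` puts the points `(G j x)` and the weights `s` into the unit ball, with margin
`1 / (6 * B)` (`hasMargin_of_weights`). So `mc(C) ≤ 6 * n * e^ε`, and as `n * e^ε ≥ 1` this also
bounds `mc(C) ^ (2/3)`.
-/

noncomputable section

/-! ### Expectations under discrete laws -/

/-- The expectation of a `[0, ∞]`-valued function under a discrete law. -/
def PMF.expect {α : Type*} (p : PMF α) (φ : α → ℝ≥0∞) : ℝ≥0∞ :=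
  ∑' a, p a * φ a

section Expect

variable {α β : Type*}

theorem PMF.expect_bind (p : PMF α) (k : α → PMF β) (φ : β → ℝ≥0∞) :
    (p.bind k).expect φ = p.expect fun a => (k a).expect φ := by
  simp only [PMF.expect, PMF.bind_apply, ← ENNReal.tsum_mul_right, ← ENNReal.tsum_mul_left]
  rw [ENNReal.tsum_comm]
  simp only [mul_assoc]

theorem PMF.expect_comm (p : PMF α) (q : PMF β) (φ : α → β → ℝ≥0∞) :
    (p.expect fun a => q.expect (φ a)) = q.expect fun b => p.expect fun a => φ a b := by
  simp only [PMF.expect, ← ENNReal.tsum_mul_left]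
  rw [ENNReal.tsum_comm]
  simp only [mul_left_comm]

theorem PMF.expect_pure (a : α) (φ : α → ℝ≥0∞) : (PMF.pure a).expect φ = φ a := by
  rw [PMF.expect, tsum_eq_single a]
  · simp
  · intro b hb
    simp [PMF.pure_apply, hb]

theorem PMF.expect_map (p : PMF α) (g : α → β) (φ : β → ℝ≥0∞) :
    (p.map g).expect φ = p.expect fun a => φ (g a) := by
  rw [← PMF.bind_pure_comp, PMF.expect_bind]
  simp only [Function.comp_apply, PMF.expect_pure]

theorem PMF.expect_mono (p : PMF α) {φ ψ : α → ℝ≥0∞} (h : ∀ a, φ a ≤ ψ a) :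
    p.expect φ ≤ p.expect ψ :=
  ENNReal.tsum_le_tsum fun a => mul_le_mul_right (h a) _

theorem PMF.expect_add (p : PMF α) (φ ψ : α → ℝ≥0∞) :
    (p.expect fun a => φ a + ψ a) = p.expect φ + p.expect ψ := by
  simp only [PMF.expect, mul_add, ENNReal.tsum_add]

theorem PMF.expect_const (p : PMF α) (c : ℝ≥0∞) : (p.expect fun _ => c) = c := by
  simp only [PMF.expect, ENNReal.tsum_mul_right, p.tsum_coe, one_mul]

theorem PMF.expect_mul_const (p : PMF α) (φ : α → ℝ≥0∞) (c : ℝ≥0∞) :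
    (p.expect fun a => φ a * c) = p.expect φ * c := by
  simp only [PMF.expect, ← mul_assoc, ENNReal.tsum_mul_right]

theorem PMF.expect_le_one (p : PMF α) {φ : α → ℝ≥0∞} (h : ∀ a, φ a ≤ 1) : p.expect φ ≤ 1 :=
  (p.expect_mono h).trans_eq (p.expect_const 1)

theorem PMF.toOuterMeasure_eq_expect (p : PMF α) (s : Set α) :
    p.toOuterMeasure s = p.expect (s.indicator 1) := by
  rw [PMF.toOuterMeasure_apply, PMF.expect]
  refine tsum_congr fun a => ?_
  by_cases h : a ∈ s <;> simp [h]

theorem PMF.bind_apply_eq_expect (p : PMF α) (k : α → PMF β) (b : β) :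
    p.bind k b = p.expect fun a => k a b := rfl

/-- A test function with values in `[0, 1]` distinguishes two laws by at most their total variation
distance, here written as the total mass of the positive part of the difference. -/
theorem PMF.expect_le_expect_add_tsum_sub (p q : PMF α) {φ : α → ℝ≥0∞} (h : ∀ a, φ a ≤ 1) :
    p.expect φ ≤ q.expect φ + ∑' a, (p a - q a) := by
  rw [PMF.expect, PMF.expect, ← ENNReal.tsum_add]
  refine ENNReal.tsum_le_tsum fun a => ?_
  calc p a * φ a ≤ (q a + (p a - q a)) * φ a := mul_le_mul_left le_add_tsub _
    _ ≤ q a * φ a + (p a - q a) := by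
        rw [add_mul]
        exact add_le_add le_rfl ((mul_le_mul_right (h a) _).trans_eq (mul_one _))

end Expect

/-! ### Random histories -/

/-- The law of the list of the first `t` values (most recent first) of a process in which the next
value is drawn from `k h`, where `h` is the list of the values so far. -/
def historyChain {W : Type*} (k : List W → PMF W) : ℕ → PMF (List W)
  | 0 => PMF.pure []
  | t + 1 => (historyChain k t).bind fun h => (k h).map fun w => w :: h

section Chain

variable {W : Type*} (k : List W → PMF W)

theorem historyChain_expect_succ (t : ℕ) (φ : List W → ℝ≥0∞) :
    (historyChain k (t + 1)).expect φ =
      (historyChain k t).expect fun h => (k h).expect fun w => φ (w :: h) := by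
  simp only [historyChain, PMF.expect_bind, PMF.expect_map]

theorem historyChain_apply_cons (t : ℕ) (w : W) (h : List W) :
    historyChain k (t + 1) (w :: h) = historyChain k t h * k h w := by
  classical
  rw [historyChain, PMF.bind_apply, tsum_eq_single h]
  · congr 1
    rw [PMF.map_apply, tsum_eq_single w]
    · simp
    · intro w' hw'
      simp [Ne.symm hw']
  · intro h' hh'
    rw [PMF.map_apply]
    simp [Ne.symm hh']

theorem historyChain_apply_of_length_ne (t : ℕ) (h : List W) (ht : h.length ≠ t) :
    historyChain k t h = 0 := by
  induction t generalizing h with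
  | zero =>
    cases h with
    | nil => simp at ht
    | cons w h => simp [historyChain, PMF.pure_apply]
  | succ t ih =>
    cases h with
    | nil => simp [historyChain, PMF.bind_apply, PMF.map_apply]
    | cons w h =>
      rw [historyChain_apply_cons, ih h (by simpa using ht), zero_mul]

theorem historyChain_expect_mono (t : ℕ) {φ ψ : List W → ℝ≥0∞}
    (hφ : ∀ h, h.length = t → φ h ≤ ψ h) :
    (historyChain k t).expect φ ≤ (historyChain k t).expect ψ := by
  refine ENNReal.tsum_le_tsum fun h => ?_
  by_cases hh : h.length = t
  · exact mul_le_mul_right (hφ h hh) _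
  · simp [historyChain_apply_of_length_ne k t h hh]

/-- Hybrid argument: if one step of the two processes can be distinguished with advantage at most
`δ t` at time `t`, then the histories are distinguished with advantage at most the sum. -/
theorem historyChain_expect_le (k' : List W → PMF W) (δ : ℕ → ℝ≥0∞) (T : ℕ)
    (hδ : ∀ t < T, ∀ h : List W, h.length = t → ∀ ψ : W → ℝ≥0∞, (∀ w, ψ w ≤ 1) →
      (k h).expect ψ ≤ (k' h).expect ψ + δ t)
    (φ : List W → ℝ≥0∞) (hφ : ∀ h, φ h ≤ 1) :
    (historyChain k T).expect φ ≤ (historyChain k' T).expect φ + ∑ t ∈ Finset.range T, δ t := by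
  induction T generalizing φ with
  | zero => simp [historyChain]
  | succ T ih =>
    rw [historyChain_expect_succ, historyChain_expect_succ, Finset.sum_range_succ]
    calc _ ≤ (historyChain k T).expect fun h => ((k' h).expect fun w => φ (w :: h)) + δ T :=
          historyChain_expect_mono k T fun h hh =>
            hδ T T.lt_succ_self h hh _ fun w => hφ _
      _ = ((historyChain k T).expect fun h => (k' h).expect fun w => φ (w :: h)) + δ T := by
          rw [PMF.expect_add, PMF.expect_const]
      _ ≤ _ := by
          rw [← add_assoc]
          exact add_le_add (ih (fun t ht => hδ t (ht.trans T.lt_succ_self)) _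
            fun h => PMF.expect_le_one _ fun w => hφ _) le_rfl

end Chain

/-! ### Protocols on independent data -/

/-- The law of the value received in a step, when the entries of the dataset are fresh samples
of `p`. -/
def Step.meanLaw {Z W : Type*} {n : ℕ} (p : PMF Z) : Step Z W n → PMF W
  | .coin q => q
  | .query _ R => p.bind R

theorem Step.law_query {Z W : Type*} {n : ℕ} (S : Fin n → Z) (i : Fin n) (R : Z → PMF W) :
    (Step.query i R).law S = R (S i) := rfl

theorem Step.meanLaw_query {Z W : Type*} {n : ℕ} (p : PMF Z) (i : Fin n) (R : Z → PMF W) :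
    (Step.query i R).meanLaw p = p.bind R := rfl

/-- Resampling one coordinate does not change the law of an i.i.d. sample. -/
theorem iidSample_expect_update {Z : Type*} (p : PMF Z) {n : ℕ} (i : Fin n)
    (Φ : (Fin n → Z) → ℝ≥0∞) :
    ((iidSample p n).expect fun S => p.expect fun z => Φ (Function.update S i z)) =
      (iidSample p n).expect Φ := by
  induction n with
  | zero => exact i.elim0
  | succ n ih =>
    simp only [iidSample, PMF.expect_bind, PMF.expect_map]
    refine Fin.cases ?_ (fun j => ?_) i
    · simp only [Fin.update_cons_zero, PMF.expect_const]
      exact PMF.expect_comm _ _ _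
    · simp only [← Fin.cons_update]
      congr 1
      funext z
      exact ih j fun S => Φ (Fin.cons z S)

namespace Protocol

variable {Z W H : Type*} {n : ℕ} (P : Protocol Z W H n)

theorem history_eq_historyChain (S : Fin n → Z) (t : ℕ) :
    P.history S t = historyChain (fun h => (P.next h).law S) t := by
  induction t with
  | zero => rfl
  | succ t ih => rw [history, historyChain, ih]

theorem spent_cons (b : List W → ℝ) (i : Fin n) (w : W) (h : List W) [Decidable
    (∃ R, P.next h = .query i R)] :
    P.spent b i (w :: h) = P.spent b i h + if ∃ R, P.next h = .query i R then b h else 0 := by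
  rw [spent]
  congr

theorem spent_nonneg {b : List W → ℝ} (i : Fin n) (h : List W)
    (hb : ∀ h', h'.length < h.length → ∀ R, P.next h' = .query i R → 0 ≤ b h') :
    0 ≤ P.spent b i h := by
  classical
  induction h with
  | nil => simp [spent]
  | cons w h ih =>
    rw [spent_cons]
    refine add_nonneg (ih fun h' hh' => hb h' (hh'.trans (by simp))) ?_
    split_ifs with hR
    · obtain ⟨R, hR⟩ := hR
      exact hb h (by simp) R hR
    · exact le_rfl

/-- The probability of a history does not depend on the data entries it has not queried. -/
theorem historyChain_update_of_spent_le_zero (S : Fin n → Z) (i : Fin n) (z : Z) (h : List W)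
    (hs : P.spent (fun _ => 1) i h ≤ 0) :
    historyChain (fun h => (P.next h).law (Function.update S i z)) h.length h =
      historyChain (fun h => (P.next h).law S) h.length h := by
  classical
  induction h with
  | nil => rfl
  | cons w h ih =>
    rw [spent_cons] at hs
    have h0 : 0 ≤ P.spent (fun _ => 1) i h := P.spent_nonneg i h fun _ _ _ _ => zero_le_one
    have hq : ¬ ∃ R, P.next h = .query i R := by
      intro hq
      rw [if_pos hq] at hs
      linarith
    rw [if_neg hq, add_zero] at hs
    rw [List.length_cons, historyChain_apply_cons, historyChain_apply_cons, ih hs]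
    congr 1
    cases hn : P.next h with
    | coin q => rfl
    | query j R =>
      have hji : j ≠ i := by
        rintro rfl
        exact hq ⟨R, hn⟩
      simp [Step.law, Function.update_of_ne hji]

/-- Since no entry is queried twice, each query on i.i.d. data behaves as if it were made on a
fresh sample, independent of the history. -/
theorem expect_history_apply (hP : P.QueriesOnce) (p : PMF Z) (h : List W)
    (hh : h.length ≤ P.rounds) :
    ((iidSample p n).expect fun S => historyChain (fun h => (P.next h).law S) h.length h) =
      historyChain (fun h => (P.next h).meanLaw p) h.length h := by
  classical
  induction h with
  | nil => simp [historyChain, PMF.expect_const]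
  | cons w h ih =>
    have ih := ih ((Nat.le_succ _).trans hh)
    simp only [List.length_cons, historyChain_apply_cons]
    rw [← ih]
    cases hn : P.next h with
    | coin q => simp only [Step.law, Step.meanLaw, PMF.expect_mul_const]
    | query i R =>
      have hs : P.spent (fun _ => 1) i h ≤ 0 := by
        have := hP (w :: h) hh i
        rw [spent_cons, if_pos ⟨R, hn⟩] at this
        linarith
      rw [← iidSample_expect_update p i]
      simp only [P.historyChain_update_of_spent_le_zero _ i _ h hs, Step.law_query,
        Step.meanLaw_query, Function.update_self]
      rw [PMF.bind_apply_eq_expect, ← PMF.expect_mul_const]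
      congr 1
      funext S
      simp only [PMF.expect, ← ENNReal.tsum_mul_left]
      exact tsum_congr fun z => mul_left_comm _ _ _

theorem iidSample_bind_run (hP : P.QueriesOnce) (p : PMF Z) :
    (iidSample p n).bind (fun S => P.run S) =
      (historyChain (fun h => (P.next h).meanLaw p) P.rounds).map P.output := by
  simp only [run, history_eq_historyChain]
  rw [← PMF.map_bind]
  congr 1
  ext h
  by_cases hh : h.length = P.rounds
  · rw [PMF.bind_apply_eq_expect, ← hh]
    exact P.expect_history_apply hP p h hh.le
  · rw [historyChain_apply_of_length_ne _ _ h hh, PMF.bind_apply]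
    simp [historyChain_apply_of_length_ne _ _ h hh]

end Protocol

/-! ### Queries that are fixed in advance -/

namespace Protocol

variable {Z W H : Type*} {n : ℕ} (P : Protocol Z W H n)

/-- Step `t` of the protocol is an oracle call with index `i` and randomizer `R`, whatever the
history. -/
def IsFixedQuery (t : ℕ) (i : Fin n) (R : Z → PMF W) : Prop :=
  t < P.rounds ∧ ∀ h : List W, h.length = t → P.next h = .query i R

open Classical in
/-- `P.fixedRandomizer t z w` is the probability of the answer `w` on the entry `z` if step `t` is
an oracle call that is fixed in advance, and `0` for all other `t`. -/
def fixedRandomizer (t : ℕ) (z : Z) (w : W) : ℝ≥0∞ :=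
  if hq : ∃ i R, P.IsFixedQuery t i R then hq.choose_spec.choose z w else 0

theorem fixedRandomizer_eq_zero {t : ℕ} (hq : ¬ ∃ i R, P.IsFixedQuery t i R) (z : Z) (w : W) :
    P.fixedRandomizer t z w = 0 := by
  rw [fixedRandomizer, dif_neg hq]

theorem exists_fixedRandomizer_eq {t : ℕ} (hq : ∃ i R, P.IsFixedQuery t i R) :
    ∃ i R, P.IsFixedQuery t i R ∧ ∀ z w, P.fixedRandomizer t z w = R z w :=
  ⟨hq.choose, hq.choose_spec.choose, hq.choose_spec.choose_spec, fun z w => by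
    rw [fixedRandomizer, dif_pos hq]⟩

theorem IsFixedQuery.fixedRandomizer_eq {P : Protocol Z W H n} {t : ℕ} {i : Fin n}
    {R : Z → PMF W} (hq : P.IsFixedQuery t i R) [Nonempty W] (z : Z) (w : W) :
    P.fixedRandomizer t z w = R z w := by
  obtain ⟨i', R', hq', heq⟩ := P.exists_fixedRandomizer_eq ⟨i, R, hq⟩
  obtain ⟨w₀⟩ := ‹Nonempty W›
  have h := (hq.2 (List.replicate t w₀) (by simp)).symm.trans
    (hq'.2 (List.replicate t w₀) (by simp))
  rw [Step.query.injEq] at h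
  rw [heq, h.2]

theorem fixedRandomizer_le_one (t : ℕ) (z : Z) (w : W) : P.fixedRandomizer t z w ≤ 1 := by
  by_cases hq : ∃ i R, P.IsFixedQuery t i R
  · obtain ⟨i, R, -, heq⟩ := P.exists_fixedRandomizer_eq hq
    rw [heq]
    exact PMF.coe_le_one _ _
  · simp [P.fixedRandomizer_eq_zero hq]

/-- A privacy cost is never negative, because the probabilities of the answers sum to one. -/
theorem _root_.IsLocalRandomizer.nonneg [Nonempty Z] {ε : ℝ} {R : Z → PMF W}
    (hR : IsLocalRandomizer ε R) : 0 ≤ ε := by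
  obtain ⟨z⟩ := ‹Nonempty Z›
  have h : ∑' w, R z w ≤ ∑' w, ENNReal.ofReal (Real.exp ε) * R z w :=
    ENNReal.tsum_le_tsum (hR z z)
  rw [ENNReal.tsum_mul_left, PMF.tsum_coe, mul_one, ENNReal.one_le_ofReal] at h
  exact Real.one_le_exp_iff.1 h

/-- All costs being nonnegative, each single call of an `ε`-LDP protocol is `ε`-private. -/
theorem IsLDP.isLocalRandomizer [Nonempty Z] [Nonempty W] {P : Protocol Z W H n} {ε : ℝ}
    (hP : P.IsLDP ε) {h : List W} (hh : h.length < P.rounds) {i : Fin n} {R : Z → PMF W}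
    (hR : P.next h = .query i R) : IsLocalRandomizer ε R := by
  classical
  obtain ⟨b, hb, hs⟩ := hP
  obtain ⟨w₀⟩ := ‹Nonempty W›
  have h1 := hs (w₀ :: h) hh i
  rw [spent_cons, if_pos ⟨R, hR⟩] at h1
  have h2 : 0 ≤ P.spent b i h := P.spent_nonneg i h fun h' hh' R' hR' =>
    (hb h' (hh'.trans hh) i R' hR').nonneg
  intro z₁ z₂ w
  refine (hb h hh i R hR z₁ z₂ w).trans (mul_le_mul_left ?_ _)
  exact ENNReal.ofReal_le_ofReal (Real.exp_le_exp.2 (by linarith))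

theorem IsLDP.fixedRandomizer_le {P : Protocol Z W H n} {ε : ℝ} (hP : P.IsLDP ε) (t : ℕ)
    (z₁ z₂ : Z) (w : W) :
    P.fixedRandomizer t z₁ w ≤ ENNReal.ofReal (Real.exp ε) * P.fixedRandomizer t z₂ w := by
  by_cases hq : ∃ i R, P.IsFixedQuery t i R
  · obtain ⟨i, R, hq, heq⟩ := P.exists_fixedRandomizer_eq hq
    have : Nonempty Z := ⟨z₁⟩
    have : Nonempty W := ⟨w⟩
    rw [heq, heq]
    have hl : (List.replicate t w).length = t := by simp
    exact hP.isLocalRandomizer (by simpa using hq.1) (hq.2 _ hl) z₁ z₂ w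
  · simp [P.fixedRandomizer_eq_zero hq]

/-- A call raises the count of its index above that of every earlier history. -/
theorem spent_add_one_le [Nonempty W] {i : Fin n} {R : Z → PMF W} (h l : List W)
    (hR : P.next h = .query i R) (w : W) :
    P.spent (fun _ => 1) i h + 1 ≤ P.spent (fun _ => 1) i (l ++ w :: h) := by
  classical
  induction l with
  | nil => rw [List.nil_append, spent_cons, if_pos ⟨R, hR⟩]
  | cons w' l ih =>
    rw [List.cons_append, spent_cons]
    split_ifs <;> linarith

theorem QueriesOnce.fixed_index_ne [Nonempty W] {P : Protocol Z W H n} (hP : P.QueriesOnce)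
    {t t' : ℕ} (htt' : t < t') {i i' : Fin n} {R R' : Z → PMF W} (hq : P.IsFixedQuery t i R)
    (hq' : P.IsFixedQuery t' i' R') : i ≠ i' := by
  classical
  rintro rfl
  obtain ⟨w₀⟩ := ‹Nonempty W›
  have h1 := P.spent_add_one_le (List.replicate t w₀) (List.replicate (t' - t - 1) w₀)
    (hq.2 _ (by simp)) w₀
  have h0 : 0 ≤ P.spent (fun _ => 1) i (List.replicate t w₀) :=
    P.spent_nonneg i _ fun _ _ _ _ => zero_le_one
  set h := List.replicate (t' - t - 1) w₀ ++ w₀ :: List.replicate t w₀ with hh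
  have hlen : h.length = t' := by
    simp [hh]
    omega
  have h2 := hP (w₀ :: h) (by simpa [hlen] using hq'.1) i
  rw [spent_cons, if_pos ⟨R', hq'.2 h hlen⟩] at h2
  linarith

/-- Calls that are fixed in advance use distinct indices, so there are at most `n` of them, and each
has answer probabilities of total mass one. -/
theorem QueriesOnce.tsum_fixedRandomizer_le {P : Protocol Z W H n} (hP : P.QueriesOnce) (z : Z) :
    ∑' t, ∑' w, P.fixedRandomizer t z w ≤ n := by
  classical
  rcases isEmpty_or_nonempty W with hW | hW
  · simp
  let s := (Finset.range P.rounds).filter fun t => ∃ i R, P.IsFixedQuery t i R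
  have hs : ∀ t, t ∈ s ↔ ∃ i R, P.IsFixedQuery t i R := by
    intro t
    simp only [s, Finset.mem_filter, Finset.mem_range, and_iff_right_iff_imp]
    rintro ⟨i, R, hq⟩
    exact hq.1
  have hmass : ∀ t, ∑' w, P.fixedRandomizer t z w = if t ∈ s then 1 else 0 := by
    intro t
    split_ifs with ht
    · obtain ⟨i, R, -, heq⟩ := P.exists_fixedRandomizer_eq ((hs t).1 ht)
      simp only [heq, PMF.tsum_coe]
    · simp [P.fixedRandomizer_eq_zero (mt (hs t).2 ht)]
  simp only [hmass]
  rw [tsum_eq_sum (s := s) fun t ht => if_neg ht, Finset.sum_ite_mem, Finset.inter_self,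
    Finset.sum_const, nsmul_one, Nat.cast_le]
  choose idx hidx using fun t : s => (hs t).1 t.2
  have hinj : Function.Injective idx := by
    intro t t' heq
    obtain ⟨R, hq⟩ := hidx t
    obtain ⟨R', hq'⟩ := hidx t'
    rcases lt_trichotomy (t : ℕ) t' with h | h | h
    · exact absurd heq (hP.fixed_index_ne h hq hq')
    · exact Subtype.ext h
    · exact absurd heq.symm (hP.fixed_index_ne h hq' hq)
  simpa using Fintype.card_le_of_injective idx hinj

end Protocol

/-! ### Distinguishing a function from its negation -/

/-- The law of `(x, f x)` for `x ∼ D`. -/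
def labelled {X Y : Type*} (D : PMF X) (f : X → Y) : PMF (X × Y) :=
  D.map fun x => (x, f x)

theorem labelled_expect {X Y : Type*} (D : PMF X) (f : X → Y) (φ : X × Y → ℝ≥0∞) :
    (labelled D f).expect φ = D.expect fun x => φ (x, f x) :=
  PMF.expect_map _ _ _

theorem IsLabelIndependent.labelled_bind_eq {X Y W : Type*} {R : X × Y → PMF W}
    (hR : IsLabelIndependent R) (D : PMF X) (f g : X → Y) :
    (labelled D f).bind R = (labelled D g).bind R := by
  rw [labelled, labelled, PMF.bind_map, PMF.bind_map]
  congr 1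
  funext x
  exact hR x (f x) (g x)

/-- Only the queries that are fixed in advance tell apart two labellings of the same points. -/
theorem Protocol.expect_run_le {X Y W H : Type*} {n : ℕ} (P : Protocol (X × Y) W H n)
    (honce : P.QueriesOnce) (hna : P.IsLabelNonadaptive) (D : PMF X) (f g : X → Y)
    (φ : H → ℝ≥0∞) (hφ : ∀ y, φ y ≤ 1) :
    ((iidSample (labelled D f) n).bind fun S => P.run S).expect φ ≤
      ((iidSample (labelled D g) n).bind fun S => P.run S).expect φ +
        ∑' t, ∑' w, ((labelled D f).expect (fun z => P.fixedRandomizer t z w) -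
          (labelled D g).expect fun z => P.fixedRandomizer t z w) := by
  rw [P.iidSample_bind_run honce, P.iidSample_bind_run honce, PMF.expect_map, PMF.expect_map]
  refine (historyChain_expect_le _ (fun h => (P.next h).meanLaw (labelled D g))
    (fun t => ∑' w, ((labelled D f).expect (fun z => P.fixedRandomizer t z w) -
      (labelled D g).expect fun z => P.fixedRandomizer t z w)) P.rounds ?_ _
    fun h => hφ _).trans (add_le_add le_rfl (ENNReal.sum_le_tsum _))
  intro t ht h hh ψ hψ
  cases hn : P.next h with
  | coin q => exact le_self_add
  | query i R =>
    rcases hna t ht with ⟨s, hs⟩ | hli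
    · have hq : P.IsFixedQuery t i R :=
        ⟨ht, fun h' hh' => (hs h' hh').trans ((hs h hh).symm.trans hn)⟩
      obtain ⟨z, -⟩ := (labelled D f).support_nonempty
      have : Nonempty W := ⟨(R z).support_nonempty.some⟩
      simp only [hq.fixedRandomizer_eq]
      exact PMF.expect_le_expect_add_tsum_sub _ _ hψ
    · rw [Step.meanLaw_query, Step.meanLaw_query,
        (hli h hh i R hn).labelled_bind_eq D f g]
      exact le_self_add

/-- A hypothesis cannot agree with both `f` and `-f` on more than half of the points. -/
theorem one_le_hypError_add_hypError_neg {X : Type*} (D : PMF X) (f h : X → ℤˣ) :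
    1 ≤ hypError D f h + hypError D (-f) h := by
  have huniv : D.toOuterMeasure Set.univ = 1 :=
    (D.toOuterMeasure_apply_eq_one_iff _).2 (Set.subset_univ _)
  rw [← huniv]
  refine (MeasureTheory.measure_mono fun x _ => ?_).trans (MeasureTheory.measure_union_le _ _)
  by_cases hx : f x = h x
  · right
    simp [← hx]
  · exact Or.inl hx

/-- A weak learner for `f` and `-f` produces transcripts that distinguish the two, and all of the
distinguishing advantage comes from the queries that are fixed in advance. -/
theorem third_le_tsum_of_pacLearns {X W : Type*} {n : ℕ} {C : Set (X → ℤˣ)}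
    (hneg : ∀ f ∈ C, -f ∈ C) {ε : ℝ} {A : PMF (Protocol (X × ℤˣ) W (X → ℤˣ) n)}
    (hA : IsLabelNonadaptiveLDP A ε) (hL : PACLearns A C (1 / 2) (2 / 3)) (D : PMF X)
    {f : X → ℤˣ} (hf : f ∈ C) :
    1 / 3 ≤ ∑' P, A P * ∑' t, ∑' w,
      ((D.expect fun x => P.fixedRandomizer t (x, f x) w) -
        D.expect fun x => P.fixedRandomizer t (x, -f x) w) := by
  set E : Set (X → ℤˣ) := {h | hypError D f h < 1 / 2}
  set E' : Set (X → ℤˣ) := {h | hypError D (-f) h < 1 / 2}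
  set δ : Protocol (X × ℤˣ) W (X → ℤˣ) n → ℝ≥0∞ := fun P => ∑' t, ∑' w,
    ((D.expect fun x => P.fixedRandomizer t (x, f x) w) -
      D.expect fun x => P.fixedRandomizer t (x, -f x) w) with hδ
  have h1 : 2 / 3 ≤ (learnerOutput A D f).expect (E.indicator 1) := by
    rw [← PMF.toOuterMeasure_eq_expect]
    exact hL D f hf
  have h2 : 2 / 3 ≤ (learnerOutput A D (-f)).expect (E'.indicator 1) := by
    rw [← PMF.toOuterMeasure_eq_expect]
    exact hL D (-f) (hneg f hf)
  have h3 : (learnerOutput A D (-f)).expect (E.indicator 1) +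
      (learnerOutput A D (-f)).expect (E'.indicator 1) ≤ 1 := by
    rw [← PMF.expect_add]
    refine PMF.expect_le_one _ fun h => ?_
    by_cases hE : h ∈ E
    · have hE' : h ∉ E' := by
        intro hE'
        refine (one_le_hypError_add_hypError_neg D f h).not_gt ?_
        calc _ < (1 / 2 + 1 / 2 : ℝ≥0∞) := ENNReal.add_lt_add hE hE'
          _ = 1 := ENNReal.add_halves 1
      simp [hE, hE']
    · by_cases hE' : h ∈ E' <;> simp [hE, hE']
  have h4 : (learnerOutput A D f).expect (E.indicator 1) ≤
      (learnerOutput A D (-f)).expect (E.indicator 1) + ∑' P, A P * δ P := by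
    rw [learnerOutput, learnerOutput, PMF.expect_bind, PMF.expect_bind]
    simp only [PMF.expect]
    rw [← ENNReal.tsum_add]
    refine ENNReal.tsum_le_tsum fun P => ?_
    rw [← mul_add]
    by_cases hP : P ∈ A.support
    · obtain ⟨-, honce, hna⟩ := hA P hP
      have h := P.expect_run_le honce hna D f (-f) (E.indicator 1)
        fun h => Set.indicator_le_self' (fun _ _ => zero_le_one) h
      simp only [labelled_expect] at h
      exact mul_le_mul_right h _
    · simp [(A.apply_eq_zero_iff P).2 hP]
  have h5 : (2 / 3 + 2 / 3 : ℝ≥0∞) ≤ 1 + ∑' P, A P * δ P :=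
    calc (2 / 3 + 2 / 3 : ℝ≥0∞) ≤ ((learnerOutput A D (-f)).expect (E.indicator 1) +
          ∑' P, A P * δ P) + (learnerOutput A D (-f)).expect (E'.indicator 1) :=
          add_le_add (h1.trans h4) h2
      _ = ((learnerOutput A D (-f)).expect (E.indicator 1) +
          (learnerOutput A D (-f)).expect (E'.indicator 1)) + ∑' P, A P * δ P := by ring
      _ ≤ _ := add_le_add h3 le_rfl
  have h6 : (2 / 3 + 2 / 3 : ℝ≥0∞) = 1 + 1 / 3 := by
    rw [← ENNReal.toReal_eq_toReal_iff' (by finiteness) (by finiteness)]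
    rw [ENNReal.toReal_add (by finiteness) (by finiteness),
      ENNReal.toReal_add (by finiteness) (by finiteness)]
    norm_num
  rw [h6] at h5
  exact (ENNReal.add_le_add_iff_left ENNReal.one_ne_top).1 h5

/-! ### Margin from correlations -/

/-- A vector in `[0, 1]^F` is found by separating the convex hull of the `v x` from the open convex
set of vectors whose positive parts sum to less than `τ`. -/
theorem exists_weights_of_forall_sum_posPart {X F : Type*} [Fintype F] (v : X → F → ℝ) {τ : ℝ}
    (hτ : 0 < τ)
    (hv : ∀ (T : Finset X) (μ : X → ℝ), (∀ x ∈ T, 0 ≤ μ x) → ∑ x ∈ T, μ x = 1 →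
      τ ≤ ∑ j, max (∑ x ∈ T, μ x * v x j) 0) :
    ∃ s : F → ℝ, (∀ j, 0 ≤ s j ∧ s j ≤ 1) ∧ ∀ x, τ ≤ ∑ j, s j * v x j := by
  classical
  let U : Set (F → ℝ) := {y | ∑ j, max (y j) 0 < τ}
  have hUopen : IsOpen U := isOpen_lt (by fun_prop) continuous_const
  have hUconv : Convex ℝ U := by
    intro y hy z hz a b ha hb hab
    calc ∑ j, max ((a • y + b • z) j) 0
        ≤ ∑ j, (a * max (y j) 0 + b * max (z j) 0) := by
          refine Finset.sum_le_sum fun j _ => max_le ?_ (by positivity)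
          simp only [Pi.add_apply, Pi.smul_apply, smul_eq_mul]
          gcongr <;> exact le_max_left _ _
      _ = a * ∑ j, max (y j) 0 + b * ∑ j, max (z j) 0 := by
          rw [Finset.sum_add_distrib, Finset.mul_sum, Finset.mul_sum]
      _ < τ := by
          have hy : ∑ j, max (y j) 0 < τ := hy
          have hz : ∑ j, max (z j) 0 < τ := hz
          rcases ha.eq_or_lt with rfl | ha
          · obtain rfl : b = 1 := by linarith
            simpa using hz
          · nlinarith
  have hdisj : Disjoint U (convexHull ℝ (Set.range v)) := by
    rw [Set.disjoint_right]
    intro y hy hyU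
    rw [convexHull_range_eq_exists_affineCombination] at hy
    obtain ⟨T, μ, hμ0, hμ1, rfl⟩ := hy
    rw [T.affineCombination_eq_linear_combination v μ hμ1] at hyU
    have h := hv T μ hμ0 hμ1
    have hyU : ∑ j, max ((∑ x ∈ T, μ x • v x) j) 0 < τ := hyU
    simp only [Finset.sum_apply, Pi.smul_apply, smul_eq_mul] at hyU
    linarith
  obtain ⟨g, u, hgU, hgK⟩ :=
    geometric_hahn_banach_open hUconv hUopen (convex_convexHull ℝ _) hdisj
  have hg : ∀ y, g y = ∑ j, g (Pi.single j 1) * y j := by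
    intro y
    conv_lhs => rw [pi_eq_sum_univ' y]
    rw [map_sum]
    refine Finset.sum_congr rfl fun j _ => ?_
    rw [map_smul, smul_eq_mul, mul_comm]
  have hsingle : ∀ j c, c < τ → c * g (Pi.single j 1) < u := by
    intro j c hc
    have := hgU (Pi.single j c) <| by
      show ∑ i, max ((Pi.single j c : F → ℝ) i) 0 < τ
      rw [Finset.sum_eq_single j]
      · simpa using ⟨hc, hτ⟩
      · intro i _ hij
        simp [hij]
      · simp
    rw [show (Pi.single j c : F → ℝ) = c • Pi.single j 1 by
      rw [← Pi.single_smul, smul_eq_mul, mul_one], map_smul, smul_eq_mul] at this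
    exact this
  have hu : 0 < u := by
    have := hgU 0 (by simpa [U] using hτ)
    simpa using this
  refine ⟨fun j => g (Pi.single j 1) * (τ / u), fun j => ⟨?_, ?_⟩, fun x => ?_⟩
  · -- `U` contains the whole negative half-axes, on which `g` is bounded above.
    refine mul_nonneg ?_ (by positivity)
    by_contra! h
    have := hsingle j (u / g (Pi.single j 1)) ((div_neg_of_pos_of_neg hu h).trans hτ)
    rw [div_mul_cancel₀ _ h.ne] at this
    exact lt_irrefl _ this
  · by_contra! h
    rw [← mul_div_assoc, lt_div_iff₀ hu, one_mul] at h
    have hpos : 0 < g (Pi.single j 1) := by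
      by_contra! h'
      nlinarith
    have := hsingle j (u / g (Pi.single j 1)) (by rwa [div_lt_iff₀ hpos, mul_comm])
    rw [div_mul_cancel₀ _ hpos.ne'] at this
    exact lt_irrefl _ this
  · have h := hgK (v x) (subset_convexHull ℝ _ ⟨x, rfl⟩)
    rw [hg] at h
    calc τ = u * (τ / u) := by field_simp
      _ ≤ (∑ j, g (Pi.single j 1) * v x j) * (τ / u) := by gcongr
      _ = _ := by
        rw [Finset.sum_mul]
        exact Finset.sum_congr rfl fun j _ => by ring

/-- Functions `G j` of size at most `a j` on `X` embed `X` into the unit ball, after a rescaling of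
the coordinates by `√(a j * B)`; combinations with coefficients in `[0, 1]` become functionals of
norm at most one. -/
theorem hasMargin_of_weights {X F : Type*} [Fintype F] (C : Set (X → ℤˣ)) (a : F → ℝ) {B τ : ℝ}
    (hB : 0 < B) (ha : ∑ j, a j ≤ B) (G : F → X → ℝ) (hG : ∀ j x, |G j x| ≤ a j)
    (hC : ∀ f ∈ C, ∃ s : F → ℝ, (∀ j, 0 ≤ s j ∧ s j ≤ 1) ∧
      ∀ x, τ ≤ ∑ j, s j * (((f x : ℤ) : ℝ) * G j x)) :
    HasMargin C (τ / B) := by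
  rcases isEmpty_or_nonempty X with hX | ⟨⟨x₀⟩⟩
  · exact ⟨0, fun _ => 0, by simp, fun f _ => ⟨0, by simp, fun x => (hX.false x).elim⟩⟩
  have ha0 : ∀ j, 0 ≤ a j := fun j => (abs_nonneg _).trans (hG j x₀)
  let e := Fintype.equivFin F
  refine ⟨Fintype.card F, fun x => WithLp.toLp 2 fun k => G (e.symm k) x / √(a (e.symm k) * B),
    fun x => ?_, fun f hf => ?_⟩
  · rw [EuclideanSpace.norm_eq, Real.sqrt_le_one]
    simp only [Real.norm_eq_abs, sq_abs, div_pow]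
    rw [e.symm.sum_comp fun j => G j x ^ 2 / √(a j * B) ^ 2]
    calc ∑ j, G j x ^ 2 / √(a j * B) ^ 2 ≤ ∑ j, a j / B := by
          refine Finset.sum_le_sum fun j _ => ?_
          rw [Real.sq_sqrt (mul_nonneg (ha0 j) hB.le)]
          rcases (ha0 j).eq_or_lt with h | h
          · simp [← h]
          · rw [div_le_div_iff₀ (by positivity) hB]
            have := sq_le_sq' (neg_le_of_abs_le (hG j x)) (le_of_abs_le (hG j x))
            nlinarith
      _ ≤ 1 := by
          rw [← Finset.sum_div, div_le_one hB]
          exact ha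
  · obtain ⟨s, hs, hsx⟩ := hC f hf
    refine ⟨WithLp.toLp 2 fun k => s (e.symm k) * √(a (e.symm k) / B), ?_, fun x => ?_⟩
    · rw [EuclideanSpace.norm_eq, Real.sqrt_le_one]
      simp only [Real.norm_eq_abs, sq_abs, mul_pow]
      rw [e.symm.sum_comp fun j => s j ^ 2 * √(a j / B) ^ 2]
      calc ∑ j, s j ^ 2 * √(a j / B) ^ 2 ≤ ∑ j, a j / B := by
            refine Finset.sum_le_sum fun j _ => ?_
            have := div_nonneg (ha0 j) hB.le
            rw [Real.sq_sqrt this]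
            exact mul_le_of_le_one_left this (pow_le_one₀ (hs j).1 (hs j).2)
        _ ≤ 1 := by
            rw [← Finset.sum_div, div_le_one hB]
            exact ha
    · rw [PiLp.inner_apply]
      simp only [Real.inner_apply]
      rw [e.symm.sum_comp fun j => s j * √(a j / B) * (G j x / √(a j * B)), Finset.mul_sum]
      refine (div_le_div_of_nonneg_right (hsx x) hB.le).trans_eq ?_
      rw [Finset.sum_div]
      refine Finset.sum_congr rfl fun j _ => ?_
      rcases (ha0 j).eq_or_lt with h | h
      · -- Where `a j = 0` the coordinate is `0 / 0`, and `G j` vanishes as well.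
        have : G j x = 0 := abs_nonpos_iff.1 ((hG j x).trans_eq h.symm)
        simp [this]
      · have h1 : √(a j * B) = √(a j) * √B := Real.sqrt_mul h.le _
        have h2 : √(a j / B) = √(a j) / √B := Real.sqrt_div h.le _
        have h3 : 0 < √(a j) := Real.sqrt_pos.2 h
        have h4 : 0 < √B := Real.sqrt_pos.2 hB
        rw [h1, h2]
        conv_lhs => rw [← Real.mul_self_sqrt hB.le]
        field_simp

/-- If every `f ∈ C` has, under every finitely supported distribution, a constant amount of total
correlation with a summable family of functions, then `C` has a margin. The dimension is made finite
by discarding a tail of the family. -/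
theorem hasMargin_of_tsum_correlation {X J : Type*} (C : Set (X → ℤˣ)) (a : J → ℝ≥0∞) {B τ : ℝ}
    (hB : 0 < B) (hτ : 0 < τ) (ha : ∑' j, a j ≤ ENNReal.ofReal B) (G : J → X → ℝ)
    (hG : ∀ j x, |G j x| ≤ (a j).toReal)
    (hC : ∀ f ∈ C, ∀ (T : Finset X) (μ : X → ℝ), (∀ x ∈ T, 0 ≤ μ x) → ∑ x ∈ T, μ x = 1 →
      ENNReal.ofReal τ ≤ ∑' j, ENNReal.ofReal (∑ x ∈ T, μ x * (((f x : ℤ) : ℝ) * G j x))) :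
    HasMargin C (τ / 2 / B) := by
  classical
  have hfin : ∑' j, a j ≠ ∞ := ne_top_of_le_ne_top ENNReal.ofReal_ne_top ha
  have hfinj : ∀ j, a j ≠ ∞ := ENNReal.ne_top_of_tsum_ne_top hfin
  obtain ⟨F, hF⟩ := ((ENNReal.tendsto_tsum_compl_atTop_zero hfin).eventually_le_const
    (ENNReal.ofReal_pos.2 (half_pos hτ))).exists
  refine hasMargin_of_weights C (fun j : F => (a j).toReal) hB ?_ (fun j => G j)
    (fun j x => hG j x) fun f hf => ?_
  · rw [Finset.sum_coe_sort F fun j => (a j).toReal, ← ENNReal.toReal_sum fun j _ => hfinj j]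
    exact ENNReal.toReal_le_of_le_ofReal hB.le ((ENNReal.sum_le_tsum F).trans ha)
  refine exists_weights_of_forall_sum_posPart (fun x (j : F) => ((f x : ℤ) : ℝ) * G j x)
    (half_pos hτ) fun T μ hμ0 hμ1 => ?_
  have h := hC f hf T μ hμ0 hμ1
  have hle : ∀ j, ENNReal.ofReal (∑ x ∈ T, μ x * (((f x : ℤ) : ℝ) * G j x)) ≤ a j := by
    intro j
    refine ENNReal.ofReal_le_of_le_toReal ?_
    calc ∑ x ∈ T, μ x * (((f x : ℤ) : ℝ) * G j x) ≤ ∑ x ∈ T, μ x * (a j).toReal := by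
          refine Finset.sum_le_sum fun x hx => mul_le_mul_of_nonneg_left ?_ (hμ0 x hx)
          refine (le_abs_self _).trans ?_
          rw [abs_mul]
          rcases Int.units_eq_one_or (f x) with h | h <;> simpa [h] using hG j x
      _ = (a j).toReal := by rw [← Finset.sum_mul, hμ1, one_mul]
  rw [← ENNReal.sum_add_tsum_compl F] at h
  have h2 : ENNReal.ofReal τ ≤ ENNReal.ofReal
      (∑ j : F, max (∑ x ∈ T, μ x * (((f x : ℤ) : ℝ) * G j x)) 0 + τ / 2) := by
    refine h.trans ?_
    rw [ENNReal.ofReal_add (Finset.sum_nonneg fun _ _ => le_max_right _ _) (half_pos hτ).le]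
    refine add_le_add ?_ ((ENNReal.tsum_le_tsum fun j => hle _).trans hF)
    rw [ENNReal.ofReal_sum_of_nonneg fun _ _ => le_max_right _ _,
      ← Finset.sum_coe_sort F]
    exact Finset.sum_le_sum fun j _ => ENNReal.ofReal_le_ofReal (le_max_left _ _)
  rw [ENNReal.ofReal_le_ofReal_iff
    (add_nonneg (Finset.sum_nonneg fun _ _ => le_max_right _ _) (half_pos hτ).le)] at h2
  linarith

/-! ### The lower bound -/

/-- A finitely supported discrete law with real weights. -/
theorem exists_pmf_expect_eq_sum {X : Type*} (T : Finset X) (μ : X → ℝ) (hμ0 : ∀ x ∈ T, 0 ≤ μ x)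
    (hμ1 : ∑ x ∈ T, μ x = 1) :
    ∃ D : PMF X, ∀ φ : X → ℝ≥0∞, D.expect φ = ∑ x ∈ T, ENNReal.ofReal (μ x) * φ x := by
  classical
  have h0 : ∀ x ∉ T, (if x ∈ T then ENNReal.ofReal (μ x) else 0) = 0 := fun x hx => if_neg hx
  refine ⟨PMF.ofFinset (fun x => if x ∈ T then ENNReal.ofReal (μ x) else 0) T ?_ h0, fun φ => ?_⟩
  · rw [Finset.sum_ite_mem, Finset.inter_self, ← ENNReal.ofReal_sum_of_nonneg hμ0, hμ1,
      ENNReal.ofReal_one]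
  · rw [PMF.expect, tsum_eq_sum (s := T)]
    · refine Finset.sum_congr rfl fun x hx => ?_
      rw [PMF.ofFinset_apply, if_pos hx]
    · intro x hx
      rw [PMF.ofFinset_apply, if_neg hx, zero_mul]

theorem sum_sub_sum_eq_ofReal {X : Type*} (T : Finset X) (μ : X → ℝ) (hμ0 : ∀ x ∈ T, 0 ≤ μ x)
    (u v : X → ℝ≥0∞) (hu : ∀ x, u x ≠ ∞) (hv : ∀ x, v x ≠ ∞) :
    ∑ x ∈ T, ENNReal.ofReal (μ x) * u x - ∑ x ∈ T, ENNReal.ofReal (μ x) * v x =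
      ENNReal.ofReal (∑ x ∈ T, μ x * ((u x).toReal - (v x).toReal)) := by
  have key : ∀ u : X → ℝ≥0∞, (∀ x, u x ≠ ∞) →
      ∑ x ∈ T, ENNReal.ofReal (μ x) * u x = ENNReal.ofReal (∑ x ∈ T, μ x * (u x).toReal) := by
    intro u hu
    rw [ENNReal.ofReal_sum_of_nonneg fun x hx => mul_nonneg (hμ0 x hx) ENNReal.toReal_nonneg]
    refine Finset.sum_congr rfl fun x hx => ?_
    rw [ENNReal.ofReal_mul (hμ0 x hx), ENNReal.ofReal_toReal (hu x)]
  rw [key u hu, key v hv, ← ENNReal.ofReal_sub _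
    (Finset.sum_nonneg fun x hx => mul_nonneg (hμ0 x hx) ENNReal.toReal_nonneg),
    ← Finset.sum_sub_distrib]
  simp only [mul_sub]

section LowerBound

variable {X W : Type*} {n : ℕ} {C : Set (X → ℤˣ)} {ε : ℝ}
  {A : PMF (Protocol (X × ℤˣ) W (X → ℤˣ) n)}

/-- The total mass of the fixed queries, over all randomizations of the algorithm. -/
theorem tsum_fixedRandomizer_le (hA : IsLabelNonadaptiveLDP A ε) (z : X × ℤˣ) :
    ∑' j : Protocol (X × ℤˣ) W (X → ℤˣ) n × ℕ × W,
      A j.1 * (ENNReal.ofReal (Real.exp ε) * j.1.fixedRandomizer j.2.1 z j.2.2) ≤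
        ENNReal.ofReal (n * Real.exp ε) := by
  rw [ENNReal.tsum_prod', ENNReal.ofReal_mul (Nat.cast_nonneg n), ENNReal.ofReal_natCast]
  simp only [ENNReal.tsum_prod', ENNReal.tsum_mul_left]
  calc _ ≤ ∑' P, A P * (ENNReal.ofReal (Real.exp ε) * n) := by
        refine ENNReal.tsum_le_tsum fun P => ?_
        by_cases hP : P ∈ A.support
        · gcongr
          exact (hA P hP).2.1.tsum_fixedRandomizer_le z
        · simp [(A.apply_eq_zero_iff P).2 hP]
    _ = _ := by rw [ENNReal.tsum_mul_right, A.tsum_coe, one_mul, mul_comm]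

/-- The label-dependent part of the probability that the algorithm is the protocol `P` and the
answer to its fixed query at time `t` is `w`, as a function of the point. -/
def labelPart (A : PMF (Protocol (X × ℤˣ) W (X → ℤˣ) n))
    (j : Protocol (X × ℤˣ) W (X → ℤˣ) n × ℕ × W) (x : X) : ℝ :=
  (A j.1 * j.1.fixedRandomizer j.2.1 (x, 1) j.2.2).toReal -
    (A j.1 * j.1.fixedRandomizer j.2.1 (x, -1) j.2.2).toReal

theorem abs_labelPart_le (hA : IsLabelNonadaptiveLDP A ε) (z : X × ℤˣ)
    (j : Protocol (X × ℤˣ) W (X → ℤˣ) n × ℕ × W) (x : X) :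
    |labelPart A j x| ≤
      (A j.1 * (ENNReal.ofReal (Real.exp ε) * j.1.fixedRandomizer j.2.1 z j.2.2)).toReal := by
  have hle : ∀ y, (A j.1 * j.1.fixedRandomizer j.2.1 (x, y) j.2.2).toReal ≤
      (A j.1 * (ENNReal.ofReal (Real.exp ε) * j.1.fixedRandomizer j.2.1 z j.2.2)).toReal := by
    intro y
    refine ENNReal.toReal_mono ?_ ?_
    · exact ENNReal.mul_ne_top (A.apply_ne_top _) (ENNReal.mul_ne_top ENNReal.ofReal_ne_top
        (ne_top_of_le_ne_top ENNReal.one_ne_top (Protocol.fixedRandomizer_le_one _ _ _ _)))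
    · by_cases hP : j.1 ∈ A.support
      · gcongr
        exact (hA _ hP).1.fixedRandomizer_le _ _ _ _
      · simp [(A.apply_eq_zero_iff j.1).2 hP]
  exact abs_sub_le_of_nonneg_of_le ENNReal.toReal_nonneg (hle 1) ENNReal.toReal_nonneg (hle (-1))

/-- The margin obtained is inversely proportional to `n * e^ε`. The reference point `x₀` normalizes
the answer probabilities. -/
theorem hasMargin_of_pacLearns (hneg : ∀ f ∈ C, -f ∈ C) (hA : IsLabelNonadaptiveLDP A ε)
    (hL : PACLearns A C (1 / 2) (2 / 3)) (x₀ : X) (hn : 0 < n) :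
    HasMargin C (1 / 3 / 2 / (n * Real.exp ε)) := by
  have hn' : (0 : ℝ) < n := Nat.cast_pos.2 hn
  refine hasMargin_of_tsum_correlation C _ (mul_pos hn' (Real.exp_pos ε)) (by norm_num)
    (tsum_fixedRandomizer_le hA (x₀, 1)) (labelPart A) (abs_labelPart_le hA (x₀, 1))
    fun f hf T μ hμ0 hμ1 => ?_
  obtain ⟨D, hD⟩ := exists_pmf_expect_eq_sum T μ hμ0 hμ1
  have hfin : ∀ (P : Protocol (X × ℤˣ) W (X → ℤˣ) n) t z w, A P * P.fixedRandomizer t z w ≠ ∞ :=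
    fun P t z w => ENNReal.mul_ne_top (A.apply_ne_top _)
      (ne_top_of_le_ne_top ENNReal.one_ne_top (P.fixedRandomizer_le_one _ _ _))
  have h := third_le_tsum_of_pacLearns hneg hA hL D hf
  rw [ENNReal.tsum_prod']
  simp only [ENNReal.tsum_prod']
  rw [ENNReal.ofReal_div_of_pos (by norm_num), ENNReal.ofReal_one, ENNReal.ofReal_ofNat]
  refine h.trans_eq (tsum_congr fun P => ?_)
  rw [← ENNReal.tsum_mul_left]
  refine tsum_congr fun t => ?_
  rw [← ENNReal.tsum_mul_left]
  refine tsum_congr fun w => ?_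
  rw [hD, hD, ENNReal.mul_sub fun _ _ => A.apply_ne_top P, Finset.mul_sum, Finset.mul_sum]
  simp only [mul_left_comm (A P)]
  rw [sum_sub_sum_eq_ofReal T μ hμ0 _ _ (fun x => hfin _ _ _ _) (fun x => hfin _ _ _ _)]
  congr 1
  refine Finset.sum_congr rfl fun x _ => ?_
  rcases Int.units_eq_one_or (f x) with hx | hx <;> simp [hx, labelPart]

/-- Without samples the two labellings cannot be told apart. -/
theorem pos_of_pacLearns (hneg : ∀ f ∈ C, -f ∈ C) (hA : IsLabelNonadaptiveLDP A ε)
    (hL : PACLearns A C (1 / 2) (2 / 3)) (x₀ : X) {f : X → ℤˣ} (hf : f ∈ C) : 0 < n := by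
  rcases Nat.eq_zero_or_pos n with rfl | hn
  · have h := third_le_tsum_of_pacLearns hneg hA hL (PMF.pure x₀) hf
    simp only [PMF.expect_pure] at h
    have h0 : ∀ (P : Protocol (X × ℤˣ) W (X → ℤˣ) 0) t z w, P.fixedRandomizer t z w = 0 :=
      fun P t z w => P.fixedRandomizer_eq_zero (fun ⟨i, _⟩ => i.elim0) z w
    simp [h0] at h
  · exact hn

end LowerBound

theorem marginComplexity_le {X : Type*} {C : Set (X → ℤˣ)} {M : ℝ} (hM : 0 < M)
    (h : HasMargin C (1 / M)) : marginComplexity C ≤ ENNReal.ofReal M :=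
  sInf_le ⟨M, hM, h, rfl⟩

theorem marginComplexity_eq_zero {X : Type*} {C : Set (X → ℤˣ)} (h : ∀ γ, HasMargin C γ) :
    marginComplexity C = 0 := by
  refine le_antisymm (ENNReal.le_of_forall_pos_le_add fun r hr _ => ?_) zero_le
  rw [zero_add, ← ENNReal.ofReal_coe_nnreal]
  exact marginComplexity_le hr (h _)

end

theorem theorem1 :
    ∃ c : ℝ, 0 < c ∧
      ∀ (X : Type*) (W : Type*) (C : Set (X → ℤˣ)), (∀ f ∈ C, -f ∈ C) →
        ∀ (ε : ℝ), 0 ≤ ε → ∀ (n : ℕ) (A : PMF (Protocol (X × ℤˣ) W (X → ℤˣ) n)),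
          IsLabelNonadaptiveLDP A ε → PACLearns A C (1 / 2) (2 / 3) →
            ENNReal.ofReal c * marginComplexity C ^ (2 / 3 : ℝ) / ENNReal.ofReal (Real.exp ε)
              ≤ (n : ℝ≥0∞) := by
  refine ⟨1 / 6, by norm_num, fun X W C hneg ε hε n A hA hL => ?_⟩
  -- On an empty domain, and for an empty class, every margin is attained.
  rcases isEmpty_or_nonempty X with hX | ⟨⟨x₀⟩⟩
  · rw [marginComplexity_eq_zero fun γ =>
      ⟨0, fun _ => 0, by simp, fun f _ => ⟨0, by simp, fun x => (hX.false x).elim⟩⟩]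
    simp
  rcases C.eq_empty_or_nonempty with rfl | ⟨f, hf⟩
  · rw [marginComplexity_eq_zero fun γ => ⟨0, fun _ => 0, by simp, fun f hf => hf.elim⟩]
    simp
  have hn := pos_of_pacLearns hneg hA hL x₀ hf
  have hB : 1 ≤ n * Real.exp ε :=
    one_le_mul_of_one_le_of_one_le (Nat.one_le_cast.2 hn) (Real.one_le_exp hε)
  have hmc : marginComplexity C ≤ ENNReal.ofReal (6 * (n * Real.exp ε)) := by
    refine marginComplexity_le (by positivity) ?_
    convert hasMargin_of_pacLearns hneg hA hL x₀ hn using 1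
    field_simp
    norm_num
  have hpow : marginComplexity C ^ (2 / 3 : ℝ) ≤ ENNReal.ofReal (6 * (n * Real.exp ε)) := by
    refine (ENNReal.rpow_le_rpow hmc (by norm_num)).trans ?_
    -- Lowering the exponent from `1` to `2 / 3` is allowed since the base is at least one.
    refine (ENNReal.rpow_le_rpow_of_exponent_le ?_ (by norm_num : (2 / 3 : ℝ) ≤ 1)).trans_eq
      (ENNReal.rpow_one _)
    rw [ENNReal.one_le_ofReal]
    linarith
  refine ENNReal.div_le_of_le_mul ?_
  calc ENNReal.ofReal (1 / 6) * marginComplexity C ^ (2 / 3 : ℝ)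
      ≤ ENNReal.ofReal (1 / 6) * ENNReal.ofReal (6 * (n * Real.exp ε)) := by gcongr
    _ = ENNReal.ofReal (n * Real.exp ε) := by
        rw [← ENNReal.ofReal_mul (by norm_num)]
        congr 1
        ring
    _ = n * ENNReal.ofReal (Real.exp ε) := by
        rw [ENNReal.ofReal_mul (Nat.cast_nonneg n), ENNReal.ofReal_natCast]
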